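/- **Setting.** Let $k$ be a positive definite kernel on a set $\mathcal X$ (its Gram matrix at any finitely many distinct points is symmetric positive definite), $m_0:\mathcal X\to\mathbb R$, $f\sim\mathcal{GP}(m_0,k)$, and let $y=f(X)+\zeta\in\mathbb R^d$, where $X$ consists of $d$ distinct points and $\zeta\sim\mathcal N(0,\sigma^2 I)$ is independent of $f$ ($\sigma=0$ is allowed). Put $G=k(X,X)+\sigma^2 I$ and $b=y-m_0(X)$. *Strong calibration.* Let $u^\star\sim\mu_0$ be a random vector, let $y$ be data generated from $u^\star$, and let a procedure return $\mathcal N(\bar u(y),\bar\Sigma)$ with $\bar\Sigma$ (positive semidefinite, possibly singular) not depending on $y$. The procedure is *strongly calibrated* if, for matrices $R$ and $N$ whose columns form orthonormal bases of the row space and of the null space of $\bar\Sigma$, $(R^\top\bar\Sigma R)^{-1/2}R^\top(\bar u-u^\star)\sim\mathcal N(0,I)$ and $N^\top(\bar u-u^\star)=0$ almost surely. *Solvers.* A probabilistic linear solver maps $b$ to $\mathcal N(\bar v(b),G^{-1}-D(b))$. It is calibrated for $\mathcal N(0,G^{-1})$ if it is strongly calibrated for the truth $v\sim\mathcal N(0,G^{-1})$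 and data $b=Gv$. The associated CAGP posterior at test points $X'$ is $\mathcal N(\tilde m(X'),\tilde k(X',X'))$ with $$\tilde m(X')=m_0(X')+k(X',X)\bar v,\qquad \tilde k(X',X')=k(X',X')-k(X',X)\,D\,k(X,X').$$ **Claim.** 1. Suppose that $D$ does not depend on $y$, that the solver is calibrated for $\mathcal N(0,G^{-1})$, and that $\bar v=My+g$ for a fixed matrix $M$ and a fixed vector $g$. Then, for every finite family of test points $X'$, $$\operatorname{Cov}(f(X'),\bar v)=k(X',X)\,G^{-1}\operatorname{Cov}(y,\bar v),$$ and the CAGP posterior at $X'$ is strongly calibrated for the truth $f(X')$, $f\sim\mathcal{GP}(m_0,k)$, and the data $y=f(X)+\zeta$. 2. All three requirements in 1 are satisfied by every Bayesian solver $\bar v=S(S^\top GS)^{-1}S^\top b$, $D=S(S^\top GS)^{-1}S^\top$ with a fixed matrix $S$ of linearly independent search directions. 3. They are satisfied by every probabilistic stationary iterative method of a completely consistent iteration $v\mapsto (I-TG)v+Tb$ with $T$ a fixed nonsingular matrix: for every $m\ge 0$, $\bar v$ is the $m$-th iterate started at $0$, and $G^{-1}-D=(I-TG)^m\,G^{-1}\,\big((I-TG)^m\big)^\top$.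 4. They are not satisfied by CAGP-CG, i.e. when $\bar v=S(S^\top GS)^{-1}S^\top b$ and the columns of $S=S(b)$ are the first $m$ conjugate gradient directions for $Gv=b$ started at $0$ (only those produced before termination, if the method terminates earlier): if $1\le m$ and $m$ is smaller than the number of distinct eigenvalues of $G$, then $\bar v$ is not an affine function of $y$. -/

import Mathlib

open MeasureTheory ProbabilityTheory Matrix
open scoped MatrixOrder

noncomputable section

namespace CAGP

/-! ### Gaussian laws, kernels and Gaussian processes -/

/-- The random vector `Z` has the Gaussian law `N(a, S)` under `P`
(`S` may be a singular covariance matrix). -/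
def HasNormalLaw {Ω ι : Type*} [MeasurableSpace Ω] [Fintype ι] [DecidableEq ι] (P : Measure Ω)
    (Z : Ω → ι → ℝ) (a : ι → ℝ) (S : Matrix ι ι ℝ) : Prop :=
  HasLaw (fun ω => WithLp.toLp 2 (Z ω)) (multivariateGaussian (WithLp.toLp 2 a) S) P

/-- The kernel matrix `k(U, V)` of two finite families of points. -/
def kernelMatrix {𝒳 α β : Type*} (k : 𝒳 → 𝒳 → ℝ) (U : α → 𝒳) (V : β → 𝒳) : Matrix α β ℝ :=
  Matrix.of fun i j => k (U i) (V j)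

/-- A positive definite kernel: its Gram matrix at any finitely many distinct points is symmetric
positive definite. -/
def IsPosDefKernel {𝒳 : Type*} (k : 𝒳 → 𝒳 → ℝ) : Prop :=
  ∀ (n : ℕ) (x : Fin n → 𝒳), Function.Injective x → (kernelMatrix k x x).PosDef

/-- `f ∼ GP(m₀, k)` under `P`. -/
structure IsGP {Ω 𝒳 : Type*} [MeasurableSpace Ω] (P : Measure Ω) (f : 𝒳 → Ω → ℝ)
    (m₀ : 𝒳 → ℝ) (k : 𝒳 → 𝒳 → ℝ) : Prop where
  gaussian : IsGaussianProcess f P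
  mean_eq : ∀ x, ∫ ω, f x ω ∂P = m₀ x
  cov_eq : ∀ x x', cov[f x, f x'; P] = k x x'

/-- The cross-covariance matrix `Cov(U, V)` of two random vectors. -/
def crossCov {Ω α β : Type*} [MeasurableSpace Ω] (P : Measure Ω) (U : Ω → α → ℝ)
    (V : Ω → β → ℝ) : Matrix α β ℝ :=
  Matrix.of fun i j => cov[fun ω => U ω i, fun ω => V ω j; P]

/-- The matrix `G = k(X, X) + σ² I`. -/
def gramian {𝒳 ι : Type*} [DecidableEq ι] (k : 𝒳 → 𝒳 → ℝ) (X : ι → 𝒳) (σ : ℝ) :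
    Matrix ι ι ℝ :=
  kernelMatrix k X X + σ ^ 2 • (1 : Matrix ι ι ℝ)

/-! ### Strong calibration -/

/-- Strong calibration of a Gaussian learning procedure. The truth `u` is a random vector whose law
under `P` is the prior, `y` is the random data that the data-generating model produces from the
truth, and on data `z` the procedure returns `N(mean z, cov z)`. The covariance does not depend on
the data, and for matrices `R` and `N` whose columns form orthonormal bases of its row space and of
its null space, `(Rᵀ Σ R)^(-1/2) Rᵀ (mean y - u) ∼ N(0, I)` and `Nᵀ (mean y - u) = 0` almost
surely. -/
def IsStronglyCalibrated {Ω ι 𝒴 : Type*} [MeasurableSpace Ω] [Fintype ι] (P : Measure Ω)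
    (u : Ω → ι → ℝ) (y : Ω → 𝒴) (mean : 𝒴 → ι → ℝ) (cov : 𝒴 → Matrix ι ι ℝ) : Prop :=
  ∃ C : Matrix ι ι ℝ, (∀ z, cov z = C) ∧ C.PosSemidef ∧
    (∀ (r : ℕ) (R : Matrix ι (Fin r) ℝ), Rᵀ * R = 1 →
      Submodule.span ℝ (Set.range R.col) = Submodule.span ℝ (Set.range C.row) →
      HasNormalLaw P
        (fun ω => (CFC.sqrt (Rᵀ * C * R))⁻¹ *ᵥ (Rᵀ *ᵥ (mean (y ω) - u ω))) 0 1) ∧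
    (∀ (s : ℕ) (N : Matrix ι (Fin s) ℝ), Nᵀ * N = 1 →
      Submodule.span ℝ (Set.range N.col) = LinearMap.ker C.mulVecLin →
      ∀ᵐ ω ∂P, Nᵀ *ᵥ (mean (y ω) - u ω) = 0)

/-! ### Probabilistic linear solvers -/

/-- A Gaussian probabilistic linear solver for a fixed system `G v = b`: on the right-hand
side `b` it returns `N(mean b, G⁻¹ - downdate b)`. -/
structure Solver (ι : Type*) where
  mean : (ι → ℝ) → ι → ℝ
  downdate : (ι → ℝ) → Matrix ι ι ℝ

/-- The downdate `D` does not depend on the data. -/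
def Solver.DowndateIndep {ι : Type*} (A : Solver ι) : Prop :=
  ∀ b b', A.downdate b = A.downdate b'

/-- The solver is strongly calibrated for the prior `v ∼ N(0, G⁻¹)` and the data-generating
model `b = G v`. -/
def Solver.IsCalibrated {ι : Type*} [Fintype ι] [DecidableEq ι] (A : Solver ι)
    (G : Matrix ι ι ℝ) : Prop :=
  IsStronglyCalibrated (multivariateGaussian (0 : EuclideanSpace ℝ ι) G⁻¹)
    (fun v => WithLp.ofLp v) (fun v => G *ᵥ WithLp.ofLp v)
    A.mean (fun b => G⁻¹ - A.downdate b)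

/-- The solver mean is an affine map of the data `y`, where `b = y - a` and `a = m₀(X)`. -/
def Solver.IsAffine {ι : Type*} [Fintype ι] (A : Solver ι) (a : ι → ℝ) : Prop :=
  ∃ (M : Matrix ι ι ℝ) (g : ι → ℝ), ∀ y : ι → ℝ, A.mean (y - a) = M *ᵥ y + g

/-- The downdate `S (Sᵀ G S)⁻¹ Sᵀ` of the prior covariance `G⁻¹` after observing `Sᵀ b`. -/
def bayesDowndate {ι κ : Type*} [Fintype ι] [Fintype κ] [DecidableEq κ]
    (G : Matrix ι ι ℝ) (S : Matrix ι κ ℝ) : Matrix ι ι ℝ :=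
  S * (Sᵀ * G * S)⁻¹ * Sᵀ

/-- The Bayesian solver with fixed search directions, the columns of `S`: it conditions
`N(0, G⁻¹)` on the value of `Sᵀ b`. -/
def bayesSolver {ι κ : Type*} [Fintype ι] [Fintype κ] [DecidableEq κ]
    (G : Matrix ι ι ℝ) (S : Matrix ι κ ℝ) : Solver ι where
  mean b := bayesDowndate G S *ᵥ b
  downdate _ := bayesDowndate G S

/-- `m` steps of the probabilistic stationary iterative method of the completely consistent
iteration `v ↦ M v + T b` with `M = I - T G`: the prior `N(0, G⁻¹)` is pushed through the `m`-fold
iteration, so that the mean is the `m`-th iterate from `0` and the covariance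
is `Mᵐ G⁻¹ (Mᵐ)ᵀ`. -/
def psimSolver {ι : Type*} [Fintype ι] [DecidableEq ι] (G T : Matrix ι ι ℝ) (m : ℕ) :
    Solver ι where
  mean b := (fun v => (1 - T * G) *ᵥ v + T *ᵥ b)^[m] 0
  downdate _ := G⁻¹ - (1 - T * G) ^ m * G⁻¹ * ((1 - T * G) ^ m)ᵀ

/-- Residuals and search directions of the conjugate gradient method for `G v = b` with initial
guess zero. After the residual has vanished all directions are zero. -/
def cgResDir {ι : Type*} [Fintype ι] (G : Matrix ι ι ℝ) (b : ι → ℝ) :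
    ℕ → (ι → ℝ) × (ι → ℝ)
  | 0 => (b, b)
  | i + 1 =>
    let r := (cgResDir G b i).1
    let p := (cgResDir G b i).2
    let r' := r - ((r ⬝ᵥ r) / (p ⬝ᵥ G *ᵥ p)) • (G *ᵥ p)
    (r', r' + ((r' ⬝ᵥ r') / (r ⬝ᵥ r)) • p)

/-- The matrix of the first `m` conjugate gradient search directions (of those produced before
termination, if the method terminates earlier). -/
def cgDirections {ι : Type*} [Fintype ι] (G : Matrix ι ι ℝ) (b : ι → ℝ) (m : ℕ) :
    Matrix ι {i : Fin m // (cgResDir G b i).2 ≠ 0} ℝ :=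
  Matrix.of fun a i => (cgResDir G b i.1).2 a

open Classical in
/-- The solver behind CAGP-CG: the Bayesian formulas with the conjugate gradient search
directions, which depend on the right-hand side. -/
def cgSolver {ι : Type*} [Fintype ι] (G : Matrix ι ι ℝ) (m : ℕ) : Solver ι where
  mean b := bayesDowndate G (cgDirections G b m) *ᵥ b
  downdate b := bayesDowndate G (cgDirections G b m)

/-! ### The computation-aware Gaussian process -/

/-- The CAGP mean at the test points `X'` given data `y`: `m₀(X') + k(X', X) v̄`, where `v̄` is the
solver mean for the right-hand side `b = y - m₀(X)`. -/
def posteriorMean {𝒳 ι κ : Type*} [Fintype ι] (m₀ : 𝒳 → ℝ) (k : 𝒳 → 𝒳 → ℝ) (X : ι → 𝒳)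
    (A : Solver ι) (X' : κ → 𝒳) (y : ι → ℝ) : κ → ℝ :=
  (m₀ ∘ X') + kernelMatrix k X' X *ᵥ A.mean (y - m₀ ∘ X)

/-- The CAGP covariance at the test points `X'`: `k(X', X') - k(X', X) D k(X, X')`. -/
def posteriorCov {𝒳 ι κ : Type*} [Fintype ι] (m₀ : 𝒳 → ℝ) (k : 𝒳 → 𝒳 → ℝ) (X : ι → 𝒳)
    (A : Solver ι) (X' : κ → 𝒳) (y : ι → ℝ) : Matrix κ κ ℝ :=
  kernelMatrix k X' X' - kernelMatrix k X' X * A.downdate (y - m₀ ∘ X) * kernelMatrix k X X'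

end CAGP

end

/-! Strong calibration is a coordinate form of one statement: the error `mean - truth` has the law
`N(0, C)`, with `C` the returned covariance (`isStronglyCalibrated_iff`). Everything then becomes
covariance algebra for Gaussian vectors.

Let `v̄ = M b + h`. On `b = G v`, `v ∼ N(0, G⁻¹)`, the error is `(M G - 1) v + h`. Calibration
forces its mean to vanish, so `h = 0`, and its covariance to be `G⁻¹ - D`, so `D = M + Mᵀ - M G Mᵀ`
(`Solver.IsCalibrated.eq_of_affine`). With `K = k(X', X)`, the CAGP error is a centred Gaussian
vector, namely `K M y - f(X')` minus its mean. From `Cov(y, y) = G` and `Cov(f(X'), y) = K` its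
covariance is `k(X', X') - K (M + Mᵀ - M G Mᵀ) Kᵀ`, and the same `D` appears
(`posterior_isStronglyCalibrated`).

Bayesian and stationary solvers have a linear error `B v` with `B G⁻¹ Bᵀ = G⁻¹ - D`.

An affine CG mean would be linear, since it vanishes at `b = 0`. It is exact at eigenvectors of `G`,
so linearity makes it exact at a sum of eigenvectors, one for each eigenvalue. But the mean lies in
the Krylov space of order `m`, so exactness there yields a nonzero polynomial `X q - 1` of degree at
most `m` that vanishes at every eigenvalue, which is too many roots (`cgSolver_not_isAffine`). -/

noncomputable section

namespace CAGP

/-! ### Gaussian vectors and covariance algebra -/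

section NormalLaw

variable {Ω ι κ β : Type*} [MeasurableSpace Ω] [Fintype ι] [Fintype κ]
  {P : Measure Ω}

lemma HasNormalLaw.hasGaussianLaw [DecidableEq ι] {Z : Ω → ι → ℝ} {a : ι → ℝ}
    {S : Matrix ι ι ℝ} (h : HasNormalLaw P Z a S) : HasGaussianLaw Z P := by
  have h1 : HasGaussianLaw (fun ω => WithLp.toLp 2 (Z ω)) P :=
    ⟨by rw [HasLaw.map_eq h]; infer_instance⟩
  exact h1.map_equiv (PiLp.continuousLinearEquiv 2 ℝ fun _ : ι => ℝ)

lemma memLp_two_apply {ι : Type*} [Finite ι] {Z : Ω → ι → ℝ} (h : HasGaussianLaw Z P) (i : ι) :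
    MemLp (fun ω => Z ω i) 2 P :=
  (HasGaussianLaw.eval (X := fun i ω => Z ω i) h i).memLp_two

lemma HasNormalLaw.integral_eq [DecidableEq ι] {Z : Ω → ι → ℝ} {a : ι → ℝ}
    {S : Matrix ι ι ℝ} (h : HasNormalLaw P Z a S) (i : ι) : ∫ ω, Z ω i ∂P = a i := by
  have h1 := HasLaw.integral_comp h (f := fun x : EuclideanSpace ℝ ι => x i)
    (by fun_prop)
  have h2 := (EuclideanSpace.proj i : EuclideanSpace ℝ ι →L[ℝ] ℝ).integral_comp_comm
    (IsGaussian.integrable_fun_id (μ := multivariateGaussian (WithLp.toLp 2 a) S))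
  rw [integral_id_multivariateGaussian] at h2
  exact h1.trans h2

lemma HasNormalLaw.crossCov_eq [DecidableEq ι] {Z : Ω → ι → ℝ} {a : ι → ℝ}
    {S : Matrix ι ι ℝ} (hS : S.PosSemidef) (h : HasNormalLaw P Z a S) :
    crossCov P Z Z = S := by
  ext i j
  rw [← covariance_eval_multivariateGaussian (μ := WithLp.toLp 2 a) hS i j]
  exact HasLaw.covariance_fun_comp h (f := fun x : EuclideanSpace ℝ ι => x i)
    (g := fun x : EuclideanSpace ℝ ι => x j) (by fun_prop) (by fun_prop)

lemma crossCov_transpose {α : Type*} (U : Ω → α → ℝ) (V : Ω → β → ℝ) :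
    (crossCov P U V)ᵀ = crossCov P V U := by
  ext i j
  exact covariance_comm _ _

lemma crossCov_mulVec_left {α : Type*} [IsFiniteMeasure P] (A : Matrix α ι ℝ) {U : Ω → ι → ℝ}
    {V : Ω → β → ℝ} (hU : ∀ i, MemLp (fun ω => U ω i) 2 P)
    (hV : ∀ i, MemLp (fun ω => V ω i) 2 P) :
    crossCov P (fun ω => A *ᵥ U ω) V = A * crossCov P U V := by
  ext i j
  simp only [crossCov, of_apply, mul_apply, mulVec, dotProduct]
  rw [covariance_fun_sum_left (fun l => (hU l).const_mul _) (hV j)]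
  simp [covariance_const_mul_left]

lemma crossCov_mulVec_right {α : Type*} [IsFiniteMeasure P] (A : Matrix α ι ℝ) {U : Ω → ι → ℝ}
    {V : Ω → β → ℝ} (hU : ∀ i, MemLp (fun ω => U ω i) 2 P)
    (hV : ∀ i, MemLp (fun ω => V ω i) 2 P) :
    crossCov P V (fun ω => A *ᵥ U ω) = crossCov P V U * Aᵀ := by
  rw [← crossCov_transpose, crossCov_mulVec_left A hU hV, transpose_mul, crossCov_transpose]

lemma crossCov_add_const_right {α : Type*} [IsProbabilityMeasure P] (U : Ω → α → ℝ)
    {V : Ω → β → ℝ} (hV : ∀ i, MemLp (fun ω => V ω i) 2 P) (c : β → ℝ) :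
    crossCov P U (fun ω => V ω + c) = crossCov P U V := by
  ext i j
  exact covariance_add_const_right ((hV j).integrable one_le_two) _

lemma crossCov_sub_const_left {α : Type*} [IsProbabilityMeasure P] {U : Ω → α → ℝ}
    (V : Ω → β → ℝ) (hU : ∀ i, MemLp (fun ω => U ω i) 2 P) (c : α → ℝ) :
    crossCov P (fun ω => U ω - c) V = crossCov P U V := by
  ext i j
  exact covariance_sub_const_left ((hU i).integrable one_le_two) _

lemma crossCov_sub_const_right {α : Type*} [IsProbabilityMeasure P] (U : Ω → α → ℝ)
    {V : Ω → β → ℝ} (hV : ∀ i, MemLp (fun ω => V ω i) 2 P) (c : β → ℝ) :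
    crossCov P U (fun ω => V ω - c) = crossCov P U V := by
  ext i j
  exact covariance_sub_const_right ((hV j).integrable one_le_two) _

lemma crossCov_sub_sub {α : Type*} [IsFiniteMeasure P] {U U' : Ω → α → ℝ} {V V' : Ω → β → ℝ}
    (hU : ∀ i, MemLp (fun ω => U ω i) 2 P) (hU' : ∀ i, MemLp (fun ω => U' ω i) 2 P)
    (hV : ∀ i, MemLp (fun ω => V ω i) 2 P) (hV' : ∀ i, MemLp (fun ω => V' ω i) 2 P) :
    crossCov P (fun ω => U ω - U' ω) (fun ω => V ω - V' ω) =
      crossCov P U V - crossCov P U V' - crossCov P U' V + crossCov P U' V' := by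
  ext i j
  exact covariance_fun_sub_fun_sub (hU i) (hU' i) (hV j) (hV' j)

lemma crossCov_posSemidef [IsFiniteMeasure P] {Z : Ω → ι → ℝ}
    (hZ : ∀ i, MemLp (fun ω => Z ω i) 2 P) : (crossCov P Z Z).PosSemidef := by
  refine .of_dotProduct_mulVec_nonneg ?_ fun x => ?_
  · simpa [IsHermitian, conjTranspose_eq_transpose_of_trivial] using crossCov_transpose Z Z
  -- The quadratic form at `x` is the variance of `∑ i, x i * Z i`.
  · have h : cov[fun ω => ∑ i, x i * Z ω i, fun ω => ∑ i, x i * Z ω i; P] =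
        star x ⬝ᵥ crossCov P Z Z *ᵥ x := by
      rw [covariance_fun_sum_fun_sum (fun i => (hZ i).const_mul _) fun i => (hZ i).const_mul _]
      simp only [covariance_const_mul_left, covariance_const_mul_right, dotProduct, mulVec,
        crossCov, of_apply, star_trivial, Finset.mul_sum]
      refine Finset.sum_congr rfl fun i _ => Finset.sum_congr rfl fun j _ => ?_
      ring
    rw [← h, covariance_self]
    · exact variance_nonneg _ _
    · exact (memLp_finsetSum _ fun i _ => (hZ i).const_mul _).aestronglyMeasurable.aemeasurable

/-- A Gaussian measure is determined by its mean and covariance form, and the latter by its values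
on the standard basis. Being a covariance, `S` is automatically positive semidefinite. -/
lemma hasNormalLaw_of_hasGaussianLaw [DecidableEq ι] {Z : Ω → ι → ℝ} (hZ : HasGaussianLaw Z P)
    {a : ι → ℝ} {S : Matrix ι ι ℝ} (ha : ∀ i, ∫ ω, Z ω i ∂P = a i)
    (hS : crossCov P Z Z = S) : HasNormalLaw P Z a S := by
  have := hZ.isProbabilityMeasure
  have hL := memLp_two_apply hZ
  have hpsd : S.PosSemidef := hS ▸ crossCov_posSemidef hL
  have hZ' : HasGaussianLaw (fun ω => WithLp.toLp 2 (Z ω)) P :=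
    HasGaussianLaw.toLp_pi (X := fun i ω => Z ω i) 2 hZ
  have hm : AEMeasurable (fun ω => WithLp.toLp 2 (Z ω)) P := hZ'.aemeasurable
  refine ⟨hm, ?_⟩
  have := hZ'.isGaussian_map
  apply IsGaussian.ext
  · rw [integral_id_multivariateGaussian', integral_map hm (by fun_prop)]
    ext i
    have h2 := (EuclideanSpace.proj i : EuclideanSpace ℝ ι →L[ℝ] ℝ).integral_comp_comm
      hZ'.integrable
    exact h2.symm.trans (ha i)
  · rw [← ContinuousLinearMap.toBilinForm_inj]
    refine LinearMap.BilinForm.ext_basis (EuclideanSpace.basisFun ι ℝ).toBasis fun i j ↦ ?_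
    rw [ContinuousLinearMap.toBilinForm_apply, ContinuousLinearMap.toBilinForm_apply,
      covarianceBilin_apply_eq_cov IsGaussian.memLp_two_id,
      covarianceBilin_multivariateGaussian hpsd, covariance_map (by fun_prop) (by fun_prop) hm]
    have (i : ι) : (fun u ↦ inner ℝ ((EuclideanSpace.basisFun ι ℝ).toBasis i) u) ∘
        (fun ω => WithLp.toLp 2 (Z ω)) = fun ω ↦ Z ω i := by ext; simp [PiLp.inner_apply]
    simp_rw [this]
    rw [← hS]
    simp [crossCov]

lemma HasGaussianLaw.mulVec {α : Type*} [Fintype α] {Z : Ω → ι → ℝ} (hZ : HasGaussianLaw Z P)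
    (A : Matrix α ι ℝ) : HasGaussianLaw (fun ω => A *ᵥ Z ω) P :=
  hZ.map_fun (LinearMap.toContinuousLinearMap A.mulVecLin)

lemma HasNormalLaw.mulVec [DecidableEq ι] [DecidableEq κ] {Z : Ω → ι → ℝ} {a : ι → ℝ}
    {S : Matrix ι ι ℝ} (hS : S.PosSemidef) (h : HasNormalLaw P Z a S) (A : Matrix κ ι ℝ) :
    HasNormalLaw P (fun ω => A *ᵥ Z ω) (A *ᵥ a) (A * S * Aᵀ) := by
  have hZ := h.hasGaussianLaw
  have := hZ.isProbabilityMeasure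
  have hL := memLp_two_apply hZ
  refine hasNormalLaw_of_hasGaussianLaw (HasGaussianLaw.mulVec hZ A) (fun i => ?_) ?_
  · simp only [Matrix.mulVec, dotProduct]
    rw [integral_finsetSum _ fun j _ => ((hL j).integrable one_le_two).const_mul _]
    simp [integral_const_mul, h.integral_eq]
  · rw [crossCov_mulVec_left A hL (memLp_two_apply (HasGaussianLaw.mulVec hZ A)),
      crossCov_mulVec_right A hL hL, h.crossCov_eq hS, Matrix.mul_assoc]

lemma HasNormalLaw.congr [DecidableEq ι] {Z Z' : Ω → ι → ℝ} {a : ι → ℝ}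
    {S : Matrix ι ι ℝ} (h : HasNormalLaw P Z a S) (hZ : ∀ᵐ ω ∂P, Z' ω = Z ω) :
    HasNormalLaw P Z' a S :=
  HasLaw.congr h (hZ.mono fun ω hω => by simp only [hω])

lemma HasNormalLaw.ae_eq_zero [DecidableEq ι] {Z : Ω → ι → ℝ}
    (h : HasNormalLaw P Z 0 0) : ∀ᵐ ω ∂P, Z ω = 0 := by
  have h0 : multivariateGaussian (WithLp.toLp 2 (0 : ι → ℝ)) (0 : Matrix ι ι ℝ) =
      Measure.dirac 0 := by
    simp [multivariateGaussian]
  unfold HasNormalLaw at h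
  rw [h0] at h
  filter_upwards [h.ae_eq_of_dirac] with ω hω
  simpa using congrArg WithLp.ofLp hω

end NormalLaw

/-! ### Strong calibration as a law of the error -/

section Calibration

variable {Ω ι κ : Type*} [MeasurableSpace Ω] [Fintype ι] [Fintype κ] {P : Measure Ω}

/-- Supplies the bases `R` and `N` over which strong calibration quantifies. The subspace is carried
to `EuclideanSpace` and back because `ι → ℝ` has no inner product structure. -/
lemma exists_orthonormal_columns (V : Submodule ℝ (ι → ℝ)) :
    ∃ (r : ℕ) (R : Matrix ι (Fin r) ℝ), Rᵀ * R = 1 ∧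
      Submodule.span ℝ (Set.range R.col) = V := by
  set e := (WithLp.linearEquiv 2 ℝ (ι → ℝ)) with he
  set V' : Submodule ℝ (EuclideanSpace ℝ ι) := V.map e.symm.toLinearMap with hV'
  set B := stdOrthonormalBasis ℝ V' with hB
  refine ⟨_, Matrix.of fun i j => (B j : EuclideanSpace ℝ ι) i, ?_, ?_⟩
  · ext i j
    have h := (orthonormal_iff_ite.mp B.orthonormal) i j
    rw [Submodule.coe_inner, PiLp.inner_apply] at h
    rw [Matrix.mul_apply, Matrix.one_apply, ← h]
    exact Finset.sum_congr rfl fun k _ => mul_comm _ _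
  · have h1 : Set.range (Matrix.of fun i j => (B j : EuclideanSpace ℝ ι) i).col =
        (e.toLinearMap ∘ₗ V'.subtype) '' Set.range B := by
      rw [← Set.range_comp]
      rfl
    have h2 := B.toBasis.span_eq
    rw [B.coe_toBasis] at h2
    rw [h1, Submodule.span_image, h2, Submodule.map_comp, Submodule.map_top,
      Submodule.range_subtype, hV', ← Submodule.map_comp]
    simp

lemma mem_span_col_iff {α : Type*} {R : Matrix α κ ℝ} {x : α → ℝ} :
    x ∈ Submodule.span ℝ (Set.range R.col) ↔ ∃ c, R *ᵥ c = x := by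
  rw [← Matrix.range_mulVecLin]
  rfl

lemma mul_transpose_mulVec_of_mem_span [DecidableEq κ] {R : Matrix ι κ ℝ} (hR : Rᵀ * R = 1)
    {x : ι → ℝ} (hx : x ∈ Submodule.span ℝ (Set.range R.col)) : R *ᵥ (Rᵀ *ᵥ x) = x := by
  obtain ⟨c, rfl⟩ := mem_span_col_iff.mp hx
  rw [mulVec_mulVec c, hR, one_mulVec]

lemma mulVec_eq_zero_of_transpose_mulVec_eq_zero {C : Matrix ι ι ℝ} {R : Matrix ι κ ℝ}
    (hs : Submodule.span ℝ (Set.range R.col) = Submodule.span ℝ (Set.range C.row))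
    {x : ι → ℝ} (hx : Rᵀ *ᵥ x = 0) : C *ᵥ x = 0 := by
  ext i
  obtain ⟨c, hc⟩ : ∃ c, R *ᵥ c = C.row i := by
    rw [← mem_span_col_iff, hs]
    exact Submodule.subset_span ⟨i, rfl⟩
  change C.row i ⬝ᵥ x = 0
  rw [← hc, dotProduct_comm, dotProduct_mulVec, ← mulVec_transpose, hx, zero_dotProduct]

lemma mul_transpose_mul_of_span_eq [DecidableEq κ] {C : Matrix ι ι ℝ} (hC : C.PosSemidef)
    {R : Matrix ι κ ℝ} (hR : Rᵀ * R = 1)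
    (hs : Submodule.span ℝ (Set.range R.col) = Submodule.span ℝ (Set.range C.row)) :
    R * Rᵀ * C = C := by
  have hsymm : Cᵀ = C := by
    simpa [IsHermitian, conjTranspose_eq_transpose_of_trivial] using hC.isHermitian
  refine ext_iff_mulVec.mpr fun v => ?_
  rw [← mulVec_mulVec, ← mulVec_mulVec]
  refine mul_transpose_mulVec_of_mem_span hR ?_
  rw [hs]
  exact (mem_span_col_iff (R := Cᵀ)).mpr ⟨v, by rw [hsymm]⟩

/-- If the form vanishes at `x`, then `C (R x) = 0` by semidefiniteness. But `R x` lies in the row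
space of `C`, hence is orthogonal to itself. -/
lemma transpose_mul_mul_posDef [DecidableEq κ] {C : Matrix ι ι ℝ} (hC : C.PosSemidef)
    {R : Matrix ι κ ℝ} (hR : Rᵀ * R = 1)
    (hs : Submodule.span ℝ (Set.range R.col) = Submodule.span ℝ (Set.range C.row)) :
    (Rᵀ * C * R).PosDef := by
  have h0 : (Rᵀ * C * R).PosSemidef := by
    simpa [conjTranspose_eq_transpose_of_trivial] using hC.conjTranspose_mul_mul_same R
  refine .of_dotProduct_mulVec_pos h0.isHermitian fun x hx =>
    lt_of_le_of_ne (h0.dotProduct_mulVec_nonneg x) fun h => hx ?_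
  have h1 : C *ᵥ (R *ᵥ x) = 0 := by
    rw [← hC.dotProduct_mulVec_zero_iff, h]
    simp only [star_trivial, ← mulVec_mulVec]
    rw [dotProduct_mulVec x, vecMul_transpose]
  obtain ⟨z, hz⟩ : ∃ z, Cᵀ *ᵥ z = R *ᵥ x := by
    rw [← mem_span_col_iff]
    change _ ∈ Submodule.span ℝ (Set.range C.row)
    rw [← hs]
    exact mem_span_col_iff.mpr ⟨x, rfl⟩
  have h2 : R *ᵥ x = 0 := by
    rw [← dotProduct_self_eq_zero]
    nth_rw 1 [← hz]
    rw [mulVec_transpose, ← dotProduct_mulVec, h1, dotProduct_zero]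
  rw [← one_mulVec x, ← hR, ← mulVec_mulVec, h2, mulVec_zero]

lemma transpose_sqrt [DecidableEq κ] (A : Matrix κ κ ℝ) : (CFC.sqrt A)ᵀ = CFC.sqrt A := by
  simpa [IsHermitian, conjTranspose_eq_transpose_of_trivial] using
    (CFC.sqrt_nonneg A).posSemidef.isHermitian

lemma isUnit_det_sqrt [DecidableEq κ] {A : Matrix κ κ ℝ} (hA : A.PosDef) :
    IsUnit (CFC.sqrt A).det := by
  rw [hA.posSemidef.det_sqrt]
  simpa using (Real.sqrt_pos.mpr hA.det_pos).ne'

/-- Undoing the whitening by `R Q` turns the standard normal into `R Rᵀ w`, with covariance `R Rᵀ C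
R Rᵀ = C`; the null space condition gives `w = R Rᵀ w` almost surely. -/
lemma HasNormalLaw.of_calibrated [DecidableEq ι] {w : Ω → ι → ℝ} {C : Matrix ι ι ℝ}
    (hC : C.PosSemidef)
    (hrow : ∀ (r : ℕ) (R : Matrix ι (Fin r) ℝ), Rᵀ * R = 1 →
      Submodule.span ℝ (Set.range R.col) = Submodule.span ℝ (Set.range C.row) →
      HasNormalLaw P (fun ω => (CFC.sqrt (Rᵀ * C * R))⁻¹ *ᵥ (Rᵀ *ᵥ w ω)) 0 1)
    (hnull : ∀ (s : ℕ) (N : Matrix ι (Fin s) ℝ), Nᵀ * N = 1 →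
      Submodule.span ℝ (Set.range N.col) = LinearMap.ker C.mulVecLin →
      ∀ᵐ ω ∂P, Nᵀ *ᵥ w ω = 0) :
    HasNormalLaw P w 0 C := by
  obtain ⟨r, R, hR, hRs⟩ := exists_orthonormal_columns (Submodule.span ℝ (Set.range C.row))
  obtain ⟨s, N, hN, hNs⟩ := exists_orthonormal_columns (LinearMap.ker C.mulVecLin)
  have hpd := transpose_mul_mul_posDef hC hR hRs
  set Q := CFC.sqrt (Rᵀ * C * R) with hQ
  have hQu : IsUnit Q.det := isUnit_det_sqrt hpd
  have hQQ : Q * Q = Rᵀ * C * R := CFC.sqrt_mul_sqrt_self _ hpd.posSemidef.nonneg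
  have h1 := (hrow r R hR hRs).mulVec PosSemidef.one (R * Q)
  have hcov : R * Q * (1 : Matrix (Fin r) (Fin r) ℝ) * (R * Q)ᵀ = C := by
    have hRC := mul_transpose_mul_of_span_eq hC hR hRs
    have hsymm : Cᵀ = C := by
      simpa [IsHermitian, conjTranspose_eq_transpose_of_trivial] using hC.isHermitian
    have hCR : C * (R * Rᵀ) = C := by
      have := congrArg transpose hRC
      simpa [transpose_mul, hsymm, Matrix.mul_assoc] using this
    rw [Matrix.mul_one, transpose_mul, hQ, transpose_sqrt, ← hQ, Matrix.mul_assoc,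
      ← Matrix.mul_assoc Q, hQQ, Matrix.mul_assoc, Matrix.mul_assoc, hCR, ← Matrix.mul_assoc, hRC]
  rw [mulVec_zero, hcov] at h1
  refine h1.congr ?_
  filter_upwards [hnull s N hN hNs] with ω hω
  rw [← mulVec_mulVec, mulVec_mulVec _ Q, mul_nonsing_inv _ hQu, one_mulVec]
  -- `x` is orthogonal to the row space, hence in the span of `N`, hence orthogonal to `w ω`. It is
  -- also orthogonal to `R Rᵀ w ω`, so `x ⬝ᵥ x = 0`.
  set x := w ω - R *ᵥ (Rᵀ *ᵥ w ω) with hx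
  have hRx : Rᵀ *ᵥ x = 0 := by
    rw [hx, mulVec_sub, mulVec_mulVec (Rᵀ *ᵥ w ω), hR, one_mulVec, sub_self]
  obtain ⟨c, hc⟩ : ∃ c, N *ᵥ c = x := by
    rw [← mem_span_col_iff, hNs]
    exact mulVec_eq_zero_of_transpose_mulVec_eq_zero hRs hRx
  have hxw : x ⬝ᵥ w ω = 0 := by
    rw [← hc, dotProduct_comm, dotProduct_mulVec, ← mulVec_transpose, hω, zero_dotProduct]
  have hxR : x ⬝ᵥ R *ᵥ (Rᵀ *ᵥ w ω) = 0 := by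
    rw [dotProduct_mulVec, ← mulVec_transpose, hRx, zero_dotProduct]
  have hxx : x = 0 := by
    rw [← dotProduct_self_eq_zero]
    nth_rw 2 [hx]
    rw [dotProduct_sub, hxw, hxR, sub_zero]
  exact sub_eq_zero.mp hxx

theorem isStronglyCalibrated_iff [DecidableEq ι] {𝒴 : Type*} {u : Ω → ι → ℝ} {y : Ω → 𝒴}
    {mean : 𝒴 → ι → ℝ} {cov : 𝒴 → Matrix ι ι ℝ} :
    IsStronglyCalibrated P u y mean cov ↔ ∃ C : Matrix ι ι ℝ, (∀ z, cov z = C) ∧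
      C.PosSemidef ∧ HasNormalLaw P (fun ω => mean (y ω) - u ω) 0 C := by
  refine exists_congr fun C => and_congr_right fun _ => and_congr_right fun hC =>
    ⟨fun h => .of_calibrated hC h.1 h.2, fun h => ⟨fun r R hR hRs => ?_, fun s N _ hNs => ?_⟩⟩
  · have hpd := transpose_mul_mul_posDef hC hR hRs
    set Q := CFC.sqrt (Rᵀ * C * R) with hQ
    have hQu : IsUnit Q.det := isUnit_det_sqrt hpd
    have hQQ : Q * Q = Rᵀ * C * R := CFC.sqrt_mul_sqrt_self _ hpd.posSemidef.nonneg
    have h1 := h.mulVec hC (Q⁻¹ * Rᵀ)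
    have hcov : Q⁻¹ * Rᵀ * C * (Q⁻¹ * Rᵀ)ᵀ = 1 := by
      rw [transpose_mul, transpose_transpose, transpose_nonsing_inv, hQ, transpose_sqrt, ← hQ]
      calc Q⁻¹ * Rᵀ * C * (R * Q⁻¹) = Q⁻¹ * (Rᵀ * C * R) * Q⁻¹ := by simp only [Matrix.mul_assoc]
        _ = 1 := by
          rw [← hQQ, ← Matrix.mul_assoc, nonsing_inv_mul _ hQu, Matrix.one_mul,
            mul_nonsing_inv _ hQu]
    rw [mulVec_zero, hcov] at h1
    simpa only [mulVec_mulVec] using h1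
  · have h1 := h.mulVec hC Nᵀ
    have hCN : C * N = 0 := by
      refine ext_iff_mulVec.mpr fun v => ?_
      rw [← mulVec_mulVec, zero_mulVec]
      change N *ᵥ v ∈ LinearMap.ker C.mulVecLin
      rw [← hNs]
      exact mem_span_col_iff.mpr ⟨v, rfl⟩
    rw [mulVec_zero, transpose_transpose, Matrix.mul_assoc, hCN, Matrix.mul_zero] at h1
    exact h1.ae_eq_zero

end Calibration

/-! ### Calibrated linear solvers -/

section Solvers

variable {ι κ : Type*} [Fintype ι] [DecidableEq ι] [Fintype κ] [DecidableEq κ]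

lemma transpose_eq_of_posDef {ι : Type*} {G : Matrix ι ι ℝ} (hG : G.PosDef) : Gᵀ = G := by
  simpa [IsHermitian, conjTranspose_eq_transpose_of_trivial] using hG.isHermitian

lemma isUnit_det_of_posDef {G : Matrix ι ι ℝ} (hG : G.PosDef) : IsUnit G.det :=
  hG.det_pos.ne'.isUnit

lemma hasNormalLaw_ofLp (S : Matrix ι ι ℝ) :
    HasNormalLaw (multivariateGaussian (0 : EuclideanSpace ℝ ι) S)
      (fun v => WithLp.ofLp v) 0 S :=
  HasLaw.id

lemma Solver.isCalibrated_of_error {A : Solver ι} {G : Matrix ι ι ℝ} (hG : G.PosDef)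
    (B : Matrix ι ι ℝ) (hmean : ∀ v, A.mean (G *ᵥ v) - v = B *ᵥ v)
    (hcov : ∀ b, G⁻¹ - A.downdate b = B * G⁻¹ * Bᵀ) : A.IsCalibrated G := by
  refine isStronglyCalibrated_iff.mpr ⟨_, hcov, ?_, ?_⟩
  · simpa [conjTranspose_eq_transpose_of_trivial] using
      hG.inv.posSemidef.mul_mul_conjTranspose_same B
  · simp only [hmean]
    simpa only [mulVec_zero] using (hasNormalLaw_ofLp G⁻¹).mulVec hG.inv.posSemidef B

/-- Compare the first two moments of the error `(M G - 1) v + h` with those of `N(0, G⁻¹ - D)`. -/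
lemma Solver.IsCalibrated.eq_of_affine {A : Solver ι} {G : Matrix ι ι ℝ} (hG : G.PosDef)
    (hA : A.IsCalibrated G) {M : Matrix ι ι ℝ} {h : ι → ℝ} (hM : ∀ b, A.mean b = M *ᵥ b + h) :
    h = 0 ∧ ∀ b, A.downdate b = M + Mᵀ - M * G * Mᵀ := by
  obtain ⟨C, hC, hCp, hlaw⟩ := isStronglyCalibrated_iff.mp hA
  have hGt := transpose_eq_of_posDef hG
  have hGu := isUnit_det_of_posDef hG
  have hv := (hasNormalLaw_ofLp G⁻¹).mulVec hG.inv.posSemidef (M * G - 1)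
  have hL := memLp_two_apply hv.hasGaussianLaw
  have hrw : ∀ v : EuclideanSpace ℝ ι, A.mean (G *ᵥ WithLp.ofLp v) - WithLp.ofLp v =
      (M * G - 1) *ᵥ WithLp.ofLp v + h := fun v => by
    rw [hM, sub_mulVec, mulVec_mulVec, one_mulVec]
    abel
  simp only [hrw] at hlaw
  have hh : h = 0 := by
    ext i
    have h1 := hlaw.integral_eq i
    have h2 := hv.integral_eq i
    simp only [Pi.add_apply] at h1
    rw [integral_add ((hL i).integrable one_le_two) (integrable_const _), h2] at h1
    simpa using h1
  refine ⟨hh, fun b => ?_⟩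
  subst hh
  simp only [add_zero] at hlaw
  have h1 := hlaw.crossCov_eq hCp
  have hp : ((M * G - 1) * G⁻¹ * (M * G - 1)ᵀ).PosSemidef :=
    hG.inv.posSemidef.mul_mul_conjTranspose_same (M * G - 1)
  rw [hv.crossCov_eq hp, ← hC b] at h1
  have h2 : (M * G - 1) * G⁻¹ * (M * G - 1)ᵀ = M * G * Mᵀ - M - Mᵀ + G⁻¹ := by
    rw [transpose_sub, transpose_mul, transpose_one, hGt, Matrix.sub_mul, Matrix.mul_assoc M,
      mul_nonsing_inv _ hGu, Matrix.mul_one, Matrix.one_mul, Matrix.sub_mul, Matrix.mul_sub,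
      Matrix.mul_sub, ← Matrix.mul_assoc G⁻¹, nonsing_inv_mul _ hGu, Matrix.mul_one,
      Matrix.mul_one, Matrix.one_mul, Matrix.mul_assoc]
    abel
  rw [h2] at h1
  have h3 : A.downdate b = G⁻¹ - (G⁻¹ - A.downdate b) := by abel
  rw [h3, ← h1]
  abel

omit [DecidableEq ι] [DecidableEq κ] in
lemma transpose_mul_mul_posDef_of_linearIndependent {G : Matrix ι ι ℝ} (hG : G.PosDef)
    {S : Matrix ι κ ℝ} (hS : LinearIndependent ℝ S.col) : (Sᵀ * G * S).PosDef := by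
  simpa [conjTranspose_eq_transpose_of_trivial] using
    hG.conjTranspose_mul_mul_same (mulVec_injective_iff.mpr hS)

omit [DecidableEq ι] in
-- `D G` fixes the search space. This gives `D G D = D` for calibration, and exactness of CG at
-- eigenvectors.
lemma bayesDowndate_mul_mul {G : Matrix ι ι ℝ} (hG : G.PosDef) {S : Matrix ι κ ℝ}
    (hS : LinearIndependent ℝ S.col) : bayesDowndate G S * G * S = S := by
  have hu := isUnit_det_of_posDef (transpose_mul_mul_posDef_of_linearIndependent hG hS)
  rw [bayesDowndate, Matrix.mul_assoc, Matrix.mul_assoc, ← Matrix.mul_assoc Sᵀ, Matrix.mul_assoc S,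
    nonsing_inv_mul _ hu, Matrix.mul_one]

omit [DecidableEq ι] in
lemma bayesDowndate_transpose {G : Matrix ι ι ℝ} (hG : G.PosDef) (S : Matrix ι κ ℝ) :
    (bayesDowndate G S)ᵀ = bayesDowndate G S := by
  simp only [bayesDowndate, transpose_mul, transpose_transpose, transpose_nonsing_inv,
    transpose_eq_of_posDef hG, Matrix.mul_assoc]

lemma bayesSolver_isCalibrated {G : Matrix ι ι ℝ} (hG : G.PosDef) {S : Matrix ι κ ℝ}
    (hS : LinearIndependent ℝ S.col) : (bayesSolver G S).IsCalibrated G := by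
  have hGu := isUnit_det_of_posDef hG
  have hDGD : bayesDowndate G S * G * bayesDowndate G S = bayesDowndate G S := by
    have h := bayesDowndate_mul_mul hG hS
    nth_rw 2 [bayesDowndate]
    rw [← Matrix.mul_assoc, ← Matrix.mul_assoc, h, bayesDowndate]
  refine Solver.isCalibrated_of_error hG (bayesDowndate G S * G - 1) (fun v => ?_) fun b => ?_
  · simp [bayesSolver, sub_mulVec, mulVec_mulVec]
  · change G⁻¹ - bayesDowndate G S = _
    rw [transpose_sub, transpose_mul, transpose_one, transpose_eq_of_posDef hG,
      bayesDowndate_transpose hG, Matrix.sub_mul, Matrix.mul_assoc (bayesDowndate G S),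
      mul_nonsing_inv _ hGu, Matrix.mul_one, Matrix.one_mul, Matrix.sub_mul, Matrix.mul_sub,
      Matrix.mul_sub, ← Matrix.mul_assoc G⁻¹, nonsing_inv_mul _ hGu, Matrix.mul_one,
      Matrix.mul_one, Matrix.one_mul, ← Matrix.mul_assoc, hDGD]
    abel

lemma psimSolver_mean (G T : Matrix ι ι ℝ) (m : ℕ) :
    ∃ M : Matrix ι ι ℝ, ∀ b, (psimSolver G T m).mean b = M *ᵥ b := by
  induction m with
  | zero => exact ⟨0, fun b => by simp [psimSolver]⟩
  | succ m ih =>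
    obtain ⟨M, hM⟩ := ih
    refine ⟨(1 - T * G) * M + T, fun b => ?_⟩
    have h := hM b
    simp only [psimSolver] at h ⊢
    rw [Function.iterate_succ_apply', h, add_mulVec, mulVec_mulVec]

/-- The solution `v` is a fixed point of the iteration with `b = G v`, so each step multiplies the
error, initially `-v`, by `1 - T G`. -/
lemma psimSolver_mean_sub (G T : Matrix ι ι ℝ) (m : ℕ) (v : ι → ℝ) :
    (psimSolver G T m).mean (G *ᵥ v) - v = -(1 - T * G) ^ m *ᵥ v := by
  induction m with
  | zero => simp [psimSolver, neg_mulVec]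
  | succ m ih =>
    simp only [psimSolver] at ih ⊢
    rw [sub_eq_iff_eq_add] at ih
    rw [Function.iterate_succ_apply', ih, pow_succ', mulVec_add, mulVec_mulVec, sub_mulVec _ _ v,
      mulVec_mulVec]
    simp only [one_mulVec, mul_neg]
    abel

lemma psimSolver_isCalibrated {G : Matrix ι ι ℝ} (hG : G.PosDef) (T : Matrix ι ι ℝ) (m : ℕ) :
    (psimSolver G T m).IsCalibrated G :=
  Solver.isCalibrated_of_error hG (-(1 - T * G) ^ m) (psimSolver_mean_sub G T m) fun b => by
    simp [psimSolver]

omit [DecidableEq ι] in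
lemma Solver.isAffine_of_mulVec {A : Solver ι} {M : Matrix ι ι ℝ} (hM : ∀ b, A.mean b = M *ᵥ b)
    (a : ι → ℝ) : A.IsAffine a :=
  ⟨M, -(M *ᵥ a), fun y => by rw [hM, mulVec_sub, sub_eq_add_neg]⟩

end Solvers

/-! ### Calibration of the CAGP posterior -/

section Posterior

variable {Ω 𝒳 : Type*} [MeasurableSpace Ω] {P : Measure Ω} [IsProbabilityMeasure P]

lemma IsPosDefKernel.gramian_posDef {k : 𝒳 → 𝒳 → ℝ} (hk : IsPosDefKernel k) {d : ℕ}
    {X : Fin d → 𝒳} (hX : Function.Injective X) (σ : ℝ) : (gramian k X σ).PosDef :=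
  (hk d X hX).add_posSemidef (PosSemidef.one.smul (sq_nonneg σ))

omit [IsProbabilityMeasure P] in
lemma IsGP.hasGaussianLaw {f : 𝒳 → Ω → ℝ} {m₀ : 𝒳 → ℝ} {k : 𝒳 → 𝒳 → ℝ} (hf : IsGP P f m₀ k)
    {α : Type*} [Fintype α] (U : α → 𝒳) : HasGaussianLaw (fun ω i => f (U i) ω) P := by
  classical
  -- The points `U i` may repeat, so the law is read off from the finite set of their values.
  have h := hf.gaussian.hasGaussianLaw (Finset.univ.image U)
  exact h.map_fun (ContinuousLinearMap.pi fun i : α =>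
    ContinuousLinearMap.proj (R := ℝ) (φ := fun _ : (Finset.univ.image U) => ℝ)
      ⟨U i, Finset.mem_image_of_mem U (Finset.mem_univ i)⟩)

omit [IsProbabilityMeasure P] in
lemma IsGP.crossCov_eq {f : 𝒳 → Ω → ℝ} {m₀ : 𝒳 → ℝ} {k : 𝒳 → 𝒳 → ℝ} (hf : IsGP P f m₀ k)
    {α β : Type*} (U : α → 𝒳) (V : β → 𝒳) :
    crossCov P (fun ω i => f (U i) ω) (fun ω i => f (V i) ω) = kernelMatrix k U V := by
  ext i j
  exact hf.cov_eq _ _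

omit [IsProbabilityMeasure P] in
lemma IsGP.kernelMatrix_transpose {f : 𝒳 → Ω → ℝ} {m₀ : 𝒳 → ℝ} {k : 𝒳 → 𝒳 → ℝ}
    (hf : IsGP P f m₀ k) {α β : Type*} (U : α → 𝒳) (V : β → 𝒳) :
    (kernelMatrix k U V)ᵀ = kernelMatrix k V U := by
  rw [← hf.crossCov_eq, crossCov_transpose, hf.crossCov_eq]

variable {m₀ : 𝒳 → ℝ} {k : 𝒳 → 𝒳 → ℝ} {f : 𝒳 → Ω → ℝ} {ι κ : Type*} [Fintype ι]
  [DecidableEq ι] [Fintype κ] {X : ι → 𝒳} {σ : ℝ} {ζ : Ω → ι → ℝ} {y : Ω → ι → ℝ}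

omit [IsProbabilityMeasure P] in
-- The values of `f` at test and training points are jointly Gaussian and independent of the noise;
-- the pair is a linear image of all three.
lemma IsGP.hasGaussianLaw_prod (hf : IsGP P f m₀ k)
    (hζ : HasNormalLaw P ζ 0 (σ ^ 2 • (1 : Matrix ι ι ℝ)))
    (hfζ : IndepFun (fun ω x => f x ω) ζ P) (hy : ∀ ω i, y ω i = f (X i) ω + ζ ω i)
    (X' : κ → 𝒳) : HasGaussianLaw (fun ω => ((fun i => f (X' i) ω), y ω)) P := by
  have h1 := hf.hasGaussianLaw (Sum.elim X' X)
  have hind : IndepFun (fun ω i => f (Sum.elim X' X i) ω) ζ P :=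
    hfζ.comp (φ := fun (g : 𝒳 → ℝ) i => g (Sum.elim X' X i)) (ψ := id)
      (measurable_pi_lambda _ fun i => measurable_pi_apply _) measurable_id
  have h2 := hind.hasGaussianLaw h1 hζ.hasGaussianLaw
  let L : ((κ ⊕ ι → ℝ) × (ι → ℝ)) →L[ℝ] (κ → ℝ) × (ι → ℝ) :=
    ContinuousLinearMap.prod
      (ContinuousLinearMap.pi fun i => (ContinuousLinearMap.proj (R := ℝ)
        (φ := fun _ : κ ⊕ ι => ℝ) (Sum.inl i)).comp (ContinuousLinearMap.fst ℝ _ _))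
      (ContinuousLinearMap.pi (fun i => (ContinuousLinearMap.proj (R := ℝ)
        (φ := fun _ : κ ⊕ ι => ℝ) (Sum.inr i)).comp (ContinuousLinearMap.fst ℝ _ _)) +
        ContinuousLinearMap.snd ℝ _ _)
  have h3 := h2.map_fun L
  refine h3.congr (.of_forall fun ω => Prod.ext rfl ?_)
  ext i
  exact (hy ω i).symm

omit [IsProbabilityMeasure P] in
lemma IsGP.crossCov_noise (hf : IsGP P f m₀ k)
    (hζ : HasNormalLaw P ζ 0 (σ ^ 2 • (1 : Matrix ι ι ℝ)))
    (hfζ : IndepFun (fun ω x => f x ω) ζ P) (X' : κ → 𝒳) :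
    crossCov P (fun ω i => f (X' i) ω) ζ = 0 := by
  ext i j
  have hind : IndepFun (fun ω => f (X' i) ω) (fun ω => ζ ω j) P :=
    hfζ.comp (φ := fun (g : 𝒳 → ℝ) => g (X' i)) (ψ := fun z : ι → ℝ => z j)
      (measurable_pi_apply _) (measurable_pi_apply _)
  exact hind.covariance_eq_zero (memLp_two_apply (hf.hasGaussianLaw X') i)
    (memLp_two_apply hζ.hasGaussianLaw j)

lemma crossCov_add_right {α β : Type*} {U : Ω → α → ℝ} {V V' : Ω → β → ℝ}
    (hU : ∀ i, MemLp (fun ω => U ω i) 2 P)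
    (hV : ∀ i, MemLp (fun ω => V ω i) 2 P) (hV' : ∀ i, MemLp (fun ω => V' ω i) 2 P) :
    crossCov P U (fun ω => V ω + V' ω) = crossCov P U V + crossCov P U V' := by
  ext i j
  exact covariance_add_right (hU i) (hV j) (hV' j)

lemma IsGP.crossCov_data (hf : IsGP P f m₀ k)
    (hζ : HasNormalLaw P ζ 0 (σ ^ 2 • (1 : Matrix ι ι ℝ)))
    (hfζ : IndepFun (fun ω x => f x ω) ζ P) (hy : ∀ ω i, y ω i = f (X i) ω + ζ ω i)
    (X' : κ → 𝒳) : crossCov P (fun ω i => f (X' i) ω) y = kernelMatrix k X' X := by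
  obtain rfl : y = fun ω => (fun i => f (X i) ω) + ζ ω := by
    ext ω i
    exact hy ω i
  rw [crossCov_add_right (memLp_two_apply (hf.hasGaussianLaw X'))
    (memLp_two_apply (hf.hasGaussianLaw X)) (memLp_two_apply hζ.hasGaussianLaw),
    hf.crossCov_eq, hf.crossCov_noise hζ hfζ, add_zero]

lemma IsGP.crossCov_data_self (hf : IsGP P f m₀ k)
    (hζ : HasNormalLaw P ζ 0 (σ ^ 2 • (1 : Matrix ι ι ℝ)))
    (hfζ : IndepFun (fun ω x => f x ω) ζ P) (hy : ∀ ω i, y ω i = f (X i) ω + ζ ω i) :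
    crossCov P y y = gramian k X σ := by
  have hfX := memLp_two_apply (hf.hasGaussianLaw X)
  have hζ2 := memLp_two_apply hζ.hasGaussianLaw
  have hy2 := memLp_two_apply (hf.hasGaussianLaw_prod hζ hfζ hy X).snd
  have h1 := hf.crossCov_data hζ hfζ hy X
  have h2 : crossCov P ζ y = σ ^ 2 • (1 : Matrix ι ι ℝ) := by
    obtain rfl : y = fun ω => (fun i => f (X i) ω) + ζ ω := by
      ext ω i
      exact hy ω i
    rw [crossCov_add_right hζ2 hfX hζ2, hζ.crossCov_eq (PosSemidef.one.smul (sq_nonneg σ)),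
      ← crossCov_transpose, hf.crossCov_noise hζ hfζ, transpose_zero, zero_add]
  have h3 : crossCov P y y = crossCov P y (fun ω i => f (X i) ω) + crossCov P y ζ := by
    rw [← crossCov_add_right hy2 hfX hζ2]
    congr 1
    ext ω i
    exact hy ω i
  rw [h3, ← crossCov_transpose, h1, ← crossCov_transpose ζ, h2, hf.kernelMatrix_transpose, gramian,
    transpose_smul, transpose_one]

theorem posterior_isStronglyCalibrated [DecidableEq κ] (hf : IsGP P f m₀ k)
    (hζ : HasNormalLaw P ζ 0 (σ ^ 2 • (1 : Matrix ι ι ℝ)))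
    (hfζ : IndepFun (fun ω x => f x ω) ζ P) (hy : ∀ ω i, y ω i = f (X i) ω + ζ ω i)
    {G : Matrix ι ι ℝ} (hG : G = gramian k X σ) (hGp : G.PosDef) {A : Solver ι}
    (hA : A.IsCalibrated G) (haff : A.IsAffine (m₀ ∘ X)) (X' : κ → 𝒳) :
    crossCov P (fun ω i => f (X' i) ω) (fun ω => A.mean (y ω - m₀ ∘ X)) =
        kernelMatrix k X' X * G⁻¹ * crossCov P y (fun ω => A.mean (y ω - m₀ ∘ X)) ∧
      IsStronglyCalibrated P (fun ω i => f (X' i) ω) y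
        (posteriorMean m₀ k X A X') (posteriorCov m₀ k X A X') := by
  obtain ⟨M, g, hM⟩ := haff
  have hmean : ∀ b, A.mean b = M *ᵥ b + (M *ᵥ (m₀ ∘ X) + g) := fun b => by
    rw [← add_assoc, ← mulVec_add, ← hM, add_sub_cancel_right]
  -- Calibration removes the offset `M m₀(X) + g` and determines `D` from `M`.
  obtain ⟨hh, hD⟩ := hA.eq_of_affine hGp hmean
  rw [hh] at hmean
  simp only [add_zero] at hmean
  have hjoint := hf.hasGaussianLaw_prod hζ hfζ hy X'
  have hf2 := memLp_two_apply hjoint.fst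
  have hy2 := memLp_two_apply hjoint.snd
  have hcy := hf.crossCov_data_self hζ hfζ hy
  rw [← hG] at hcy
  have hcfy := hf.crossCov_data hζ hfζ hy X'
  refine ⟨?_, isStronglyCalibrated_iff.mpr ?_⟩
  · simp only [hM]
    have hMy := memLp_two_apply (HasGaussianLaw.mulVec hjoint.snd M)
    rw [crossCov_add_const_right _ hMy, crossCov_add_const_right _ hMy,
      crossCov_mulVec_right M hy2 hf2, crossCov_mulVec_right M hy2 hy2, hcy, hcfy,
      Matrix.mul_assoc (kernelMatrix k X' X), ← Matrix.mul_assoc G⁻¹,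
      nonsing_inv_mul _ (isUnit_det_of_posDef hGp), Matrix.one_mul]
  set K := kernelMatrix k X' X with hK
  have hKt : kernelMatrix k X X' = Kᵀ := (hf.kernelMatrix_transpose X' X).symm
  -- The expectation of `K M y - f(X')`, so the error is centred.
  set c : κ → ℝ := (K * M) *ᵥ (m₀ ∘ X) - m₀ ∘ X' with hc
  have herr : ∀ ω, posteriorMean m₀ k X A X' (y ω) - (fun i => f (X' i) ω) =
      (K * M) *ᵥ y ω - (fun i => f (X' i) ω) - c := fun ω => by
    rw [posteriorMean, hmean, mulVec_mulVec, mulVec_sub, hc]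
    abel
  have hgauss₀ : HasGaussianLaw (fun ω => (K * M) *ᵥ y ω - (fun i => f (X' i) ω)) P :=
    hjoint.map_fun ((LinearMap.toContinuousLinearMap (K * M).mulVecLin).comp
      (ContinuousLinearMap.snd ℝ _ _) - ContinuousLinearMap.fst ℝ _ _)
  have he2 := memLp_two_apply hgauss₀
  have hgauss : HasGaussianLaw (fun ω => (K * M) *ᵥ y ω - (fun i => f (X' i) ω) - c) P := by
    have := hgauss₀.isGaussian_map
    refine ⟨?_⟩
    have h : Measure.map (fun ω => (K * M) *ᵥ y ω - (fun i => f (X' i) ω) - c) P =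
        (P.map (fun ω => (K * M) *ᵥ y ω - (fun i => f (X' i) ω))).map (fun x => x - c) :=
      (AEMeasurable.map_map_of_aemeasurable (g := fun x : κ → ℝ => x - c) (by fun_prop)
        hgauss₀.aemeasurable).symm
    rw [h]
    infer_instance
  have hKMy := memLp_two_apply (HasGaussianLaw.mulVec hjoint.snd (K * M))
  have hcov : crossCov P (fun ω => (K * M) *ᵥ y ω - (fun i => f (X' i) ω) - c)
      (fun ω => (K * M) *ᵥ y ω - (fun i => f (X' i) ω) - c) =
      kernelMatrix k X' X' - K * (M + Mᵀ - M * G * Mᵀ) * Kᵀ := by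
    rw [crossCov_sub_const_left _ he2, crossCov_sub_const_right _ he2,
      crossCov_sub_sub hKMy hf2 hKMy hf2, crossCov_mulVec_left _ hy2 hKMy,
      crossCov_mulVec_left _ hy2 hf2, crossCov_mulVec_right _ hy2 hy2,
      crossCov_mulVec_right _ hy2 hf2, hcfy, hcy, hf.crossCov_eq, ← crossCov_transpose, hcfy]
    simp only [transpose_mul, Matrix.mul_add, Matrix.mul_sub, Matrix.add_mul, Matrix.sub_mul,
      Matrix.mul_assoc]
    abel
  refine ⟨kernelMatrix k X' X' - K * (M + Mᵀ - M * G * Mᵀ) * Kᵀ, fun z => ?_, ?_, ?_⟩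
  · rw [posteriorCov, hD, hKt]
  · rw [← hcov]
    exact crossCov_posSemidef (memLp_two_apply hgauss)
  · simp only [herr]
    refine hasNormalLaw_of_hasGaussianLaw hgauss (fun i => ?_) hcov
    have hyi : ∀ j, ∫ ω, y ω j ∂P = m₀ (X j) := fun j => by
      simp only [hy]
      rw [integral_add ((memLp_two_apply (hf.hasGaussianLaw X) j).integrable one_le_two)
        ((memLp_two_apply hζ.hasGaussianLaw j).integrable one_le_two), hf.mean_eq,
        hζ.integral_eq]
      simp
    have hKy : ∫ ω, ((K * M) *ᵥ y ω) i ∂P = ((K * M) *ᵥ (m₀ ∘ X)) i := by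
      simp only [Matrix.mulVec, dotProduct]
      rw [integral_finsetSum _ fun j _ => ((hy2 j).integrable one_le_two).const_mul _]
      simp [integral_const_mul, hyi]
    simp only [Pi.sub_apply]
    rw [integral_sub (f := fun ω => ((K * M) *ᵥ y ω) i - f (X' i) ω)
      (((hKMy i).integrable one_le_two).sub ((hf2 i).integrable one_le_two))
      (integrable_const _), integral_sub ((hKMy i).integrable one_le_two)
      ((hf2 i).integrable one_le_two), hKy, hf.mean_eq]
    simp [hc]

end Posterior

/-! ### Conjugate gradients are not affine in the data -/

section ConjugateGradient

open Polynomial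

variable {ι : Type*} [Fintype ι] [DecidableEq ι]

/-- The Krylov space of order `m`: polynomials in `G` of degree less than `m`, applied to `b`. -/
def krylov (G : Matrix ι ι ℝ) (b : ι → ℝ) (m : ℕ) : Submodule ℝ (ι → ℝ) :=
  (degreeLT ℝ m).map
    (((LinearMap.applyₗ b).comp (Matrix.toLin' (R := ℝ)).toLinearMap).comp
      (aeval (R := ℝ) G).toLinearMap)

lemma mem_krylov {G : Matrix ι ι ℝ} {b v : ι → ℝ} {m : ℕ} :
    v ∈ krylov G b m ↔ ∃ q : ℝ[X], q.degree < m ∧ aeval G q *ᵥ b = v := by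
  simp [krylov, mem_degreeLT]

lemma krylov_mono (G : Matrix ι ι ℝ) (b : ι → ℝ) : Monotone (krylov G b) :=
  fun _ _ h => Submodule.map_mono (degreeLT_mono h)

lemma mulVec_mem_krylov {G : Matrix ι ι ℝ} {b v : ι → ℝ} {m : ℕ} (hv : v ∈ krylov G b m) :
    G *ᵥ v ∈ krylov G b (m + 1) := by
  obtain ⟨q, hq, rfl⟩ := mem_krylov.mp hv
  refine mem_krylov.mpr ⟨X * q, ?_, ?_⟩
  · rcases eq_or_ne q 0 with rfl | h
    · simp
    · rw [degree_mul, degree_X, degree_eq_natDegree h] at *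
      norm_cast at *
      omega
  · simp [mulVec_mulVec]

lemma cgResDir_mem_krylov (G : Matrix ι ι ℝ) (b : ι → ℝ) (i : ℕ) :
    (cgResDir G b i).1 ∈ krylov G b (i + 1) ∧ (cgResDir G b i).2 ∈ krylov G b (i + 1) := by
  induction i with
  | zero =>
    have h : b ∈ krylov G b (0 + 1) := mem_krylov.mpr ⟨1, by simp, by simp⟩
    exact ⟨h, h⟩
  | succ i ih =>
    have hle := krylov_mono G b (Nat.le_succ (i + 1))
    have hr := Submodule.sub_mem _ (hle ih.1) (Submodule.smul_mem _
      (((cgResDir G b i).1 ⬝ᵥ (cgResDir G b i).1) /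
        ((cgResDir G b i).2 ⬝ᵥ G *ᵥ (cgResDir G b i).2)) (mulVec_mem_krylov ih.2))
    exact ⟨hr, Submodule.add_mem _ hr (Submodule.smul_mem _ _ (hle ih.2))⟩

lemma cgSolver_mean_mem_krylov (G : Matrix ι ι ℝ) (m : ℕ) (b : ι → ℝ) :
    (cgSolver G m).mean b ∈ krylov G b m := by
  classical
  have h : (cgSolver G m).mean b ∈
      Submodule.span ℝ (Set.range (cgDirections G b m).col) := by
    simp only [cgSolver, bayesDowndate, ← mulVec_mulVec]
    exact mem_span_col_iff.mpr ⟨_, rfl⟩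
  refine Submodule.span_le.mpr ?_ h
  rintro _ ⟨i, rfl⟩
  exact krylov_mono G b i.1.2 (cgResDir_mem_krylov G b i.1).2

omit [DecidableEq ι] in
-- For `b ≠ 0` the first step length is `1 / c`, which annihilates the residual; from then on the
-- recursion stays at zero.
lemma cgResDir_succ_eq_zero {G : Matrix ι ι ℝ} (hG : G.PosDef) {b : ι → ℝ} {c : ℝ}
    (hb : G *ᵥ b = c • b) (i : ℕ) : cgResDir G b (i + 1) = 0 := by
  induction i with
  | zero =>
    have hr : b - ((b ⬝ᵥ b) / (b ⬝ᵥ G *ᵥ b)) • (G *ᵥ b) = 0 := by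
      rcases eq_or_ne b 0 with rfl | hb0
      · simp
      have h1 : b ⬝ᵥ G *ᵥ b ≠ 0 := (hG.dotProduct_mulVec_pos hb0).ne'
      rw [hb, dotProduct_smul, smul_eq_mul] at *
      have h2 : b ⬝ᵥ b / (c * b ⬝ᵥ b) * c = 1 := by
        have := left_ne_zero_of_mul h1
        have := right_ne_zero_of_mul h1
        field_simp
      rw [smul_smul, h2, one_smul, sub_self]
    simp [cgResDir, hr]
  | succ i ih =>
    rw [cgResDir, ih]
    simp

omit [DecidableEq ι] in
-- The only nonzero search direction is `b` itself, so `D G b = b` reads `c D b = b`.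
lemma cgSolver_mean_eigenvector {G : Matrix ι ι ℝ} (hG : G.PosDef) {m : ℕ} (hm : 1 ≤ m)
    {b : ι → ℝ} (hb0 : b ≠ 0) {c : ℝ} (hb : G *ᵥ b = c • b) :
    c • (cgSolver G m).mean b = b := by
  classical
  set S := cgDirections G b m with hS
  let i₀ : {i : Fin m // (cgResDir G b i).2 ≠ 0} := ⟨⟨0, hm⟩, hb0⟩
  have huniq : ∀ i : {i : Fin m // (cgResDir G b i).2 ≠ 0}, i = i₀ := by
    rintro ⟨⟨i, hi⟩, h⟩
    cases i with
    | zero => rfl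
    | succ i => exact absurd (by simp [cgResDir_succ_eq_zero hG hb]) h
  let _ : Unique {i : Fin m // (cgResDir G b i).2 ≠ 0} := ⟨⟨i₀⟩, huniq⟩
  have hcol : S.col default = b := rfl
  have hlin : LinearIndependent ℝ S.col := by
    rw [linearIndependent_unique_iff, hcol]
    exact hb0
  have h := bayesDowndate_mul_mul hG hlin
  have hSb : S *ᵥ (Pi.single default 1) = b := by
    rw [mulVec_single_one]
    exact hcol
  have h2 := congrArg (fun A => A *ᵥ Pi.single default 1) h
  simp only [← mulVec_mulVec, hSb, hb, mulVec_smul] at h2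
  simpa only [cgSolver] using h2

lemma aeval_mulVec_eigenvector {G : Matrix ι ι ℝ} {b : ι → ℝ} {c : ℝ} (hb : G *ᵥ b = c • b)
    (q : ℝ[X]) : aeval G q *ᵥ b = q.eval c • b := by
  induction q using Polynomial.induction_on' with
  | add p q hp hq => rw [map_add, add_mulVec, hp, hq, eval_add, add_smul]
  | monomial n a =>
    have h : ∀ n, G ^ n *ᵥ b = c ^ n • b := fun n => by
      induction n with
      | zero => simp
      | succ n ih => rw [pow_succ, ← mulVec_mulVec, hb, mulVec_smul, ih, smul_smul, pow_succ']
    rw [aeval_monomial, ← mulVec_mulVec, h, eval_monomial, Algebra.algebraMap_eq_smul_one, smul_mulVec,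
      one_mulVec, smul_smul]

theorem cgSolver_not_isAffine {G : Matrix ι ι ℝ} (hG : G.PosDef) {m : ℕ} (hm : 1 ≤ m)
    (hcard : m < (spectrum ℝ G).ncard) (a : ι → ℝ) : ¬ (cgSolver G m).IsAffine a := by
  rintro ⟨M, g, hM⟩
  have hmean : ∀ b, (cgSolver G m).mean b = M *ᵥ b + (M *ᵥ a + g) := fun b => by
    rw [← add_assoc, ← mulVec_add, ← hM, add_sub_cancel_right]
  -- The mean is a matrix, depending on `b`, applied to `b`, so it vanishes at `b = 0`.
  have hzero : M *ᵥ a + g = 0 := by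
    have h := hmean 0
    simp only [cgSolver, mulVec_zero, zero_add] at h
    exact h.symm
  simp only [hzero, add_zero] at hmean
  have hfin : (spectrum ℝ G).Finite := Set.finite_of_ncard_pos (by omega)
  have hev : ∀ c : spectrum ℝ G, ∃ v, Module.End.HasEigenvector (toLin' G) (c : ℝ) v := fun c =>
    ((Module.End.hasEigenvalue_iff_mem_spectrum (f := toLin' G)).mpr
      (by rw [spectrum_toLin']; exact c.2)).exists_hasEigenvector
  choose v hv using hev
  have hlin := Module.End.eigenvectors_linearIndependent (toLin' G) (spectrum ℝ G) v hv
  have hGv : ∀ c : spectrum ℝ G, G *ᵥ v c = (c : ℝ) • v c := fun c => (hv c).apply_eq_smul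
  have := hfin.fintype
  obtain ⟨q, hq, hqb⟩ := mem_krylov.mp (cgSolver_mean_mem_krylov G m (∑ c, v c))
  have hsum : ∑ c : spectrum ℝ G, (X * q - 1).eval (c : ℝ) • v c = 0 := by
    -- The assumed linearity extends exactness from single eigenvectors to their sum.
    have h1 : G *ᵥ ((cgSolver G m).mean (∑ c, v c)) = ∑ c, v c := by
      rw [hmean, mulVec_sum, mulVec_sum]
      refine Finset.sum_congr rfl fun c _ => ?_
      have h := cgSolver_mean_eigenvector hG hm (hv c).2 (hGv c)
      rw [hmean] at h
      have hc : (c : ℝ) ≠ 0 := fun hc => (hv c).2 (by rw [← h, hc, zero_smul])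
      rw [(eq_inv_smul_iff₀ hc).mpr h, mulVec_smul, hGv c, inv_smul_smul₀ hc]
    rw [← hqb, mulVec_sum, mulVec_sum] at h1
    rw [← sub_eq_zero, ← Finset.sum_sub_distrib] at h1
    rw [← h1]
    refine Finset.sum_congr rfl fun c _ => ?_
    rw [aeval_mulVec_eigenvector (hGv c), mulVec_smul, hGv c, smul_smul, eval_sub, eval_mul, eval_X,
      eval_one, sub_smul, one_smul, mul_comm]
  -- Independence of the eigenvectors makes every eigenvalue a root of `X q - 1`, a polynomial that
  -- is nonzero because its value at `0` is `-1`.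
  have hroot := Fintype.linearIndependent_iff.mp hlin _ hsum
  have hne : X * q - 1 ≠ 0 := fun h => by
    have := congrArg (eval 0) h
    simp at this
  have hdeg : (X * q - 1).natDegree ≤ m := by
    refine (natDegree_sub_le _ _).trans (max_le ?_ (by simp))
    rcases eq_or_ne q 0 with rfl | h
    · simp
    · rw [natDegree_X_mul h]
      rw [degree_eq_natDegree h] at hq
      exact_mod_cast hq
  have hsub : hfin.toFinset ⊆ (X * q - 1).roots.toFinset := fun c hc => by
    rw [Multiset.mem_toFinset, mem_roots hne]
    exact hroot ⟨c, by simpa using hc⟩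
  have h1 := Finset.card_le_card hsub
  have h2 := Multiset.toFinset_card_le (X * q - 1).roots
  have h3 := card_roots' (X * q - 1)
  rw [Set.ncard_eq_toFinset_card _ hfin] at hcard
  omega

end ConjugateGradient

end CAGP

end

theorem mainTheorem2 {Ω 𝒳 : Type*} [MeasurableSpace Ω] (P : Measure Ω) [IsProbabilityMeasure P]
    (m₀ : 𝒳 → ℝ) (k : 𝒳 → 𝒳 → ℝ) (hk : CAGP.IsPosDefKernel k)
    (f : 𝒳 → Ω → ℝ) (hf : CAGP.IsGP P f m₀ k)
    (d : ℕ) (X : Fin d → 𝒳) (hX : Function.Injective X) (σ : ℝ)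
    (ζ : Ω → Fin d → ℝ) (hζ : CAGP.HasNormalLaw P ζ 0 (σ ^ 2 • (1 : Matrix (Fin d) (Fin d) ℝ)))
    (hfζ : IndepFun (fun ω x => f x ω) ζ P)
    (y : Ω → Fin d → ℝ) (hy : ∀ ω i, y ω i = f (X i) ω + ζ ω i)
    (G : Matrix (Fin d) (Fin d) ℝ) (hG : G = CAGP.gramian k X σ) :
    -- calibrated solvers with affine mean
    (∀ A : CAGP.Solver (Fin d), A.DowndateIndep → A.IsCalibrated G → A.IsAffine (m₀ ∘ X) →
      ∀ (d' : ℕ) (X' : Fin d' → 𝒳),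
        CAGP.crossCov P (fun ω i => f (X' i) ω) (fun ω => A.mean (y ω - m₀ ∘ X)) =
            CAGP.kernelMatrix k X' X * G⁻¹ *
              CAGP.crossCov P y (fun ω => A.mean (y ω - m₀ ∘ X)) ∧
        CAGP.IsStronglyCalibrated P (fun ω i => f (X' i) ω) y
          (CAGP.posteriorMean m₀ k X A X') (CAGP.posteriorCov m₀ k X A X')) ∧
    -- Bayesian solvers satisfy the requirements
    (∀ (m : ℕ) (S : Matrix (Fin d) (Fin m) ℝ), LinearIndependent ℝ S.col →
      (CAGP.bayesSolver G S).DowndateIndep ∧ (CAGP.bayesSolver G S).IsCalibrated G ∧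
        (CAGP.bayesSolver G S).IsAffine (m₀ ∘ X)) ∧
    -- probabilistic stationary iterative methods satisfy the requirements
    (∀ (m : ℕ) (T : Matrix (Fin d) (Fin d) ℝ), IsUnit T →
      (CAGP.psimSolver G T m).DowndateIndep ∧ (CAGP.psimSolver G T m).IsCalibrated G ∧
        (CAGP.psimSolver G T m).IsAffine (m₀ ∘ X)) ∧
    -- the conjugate gradient solver does not have an affine mean
    (∀ m : ℕ, 1 ≤ m → m < (spectrum ℝ G).ncard →
      ¬ (CAGP.cgSolver G m).IsAffine (m₀ ∘ X)) := by
  have hGp : G.PosDef := hG ▸ hk.gramian_posDef hX σ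
  refine ⟨fun A _ hA haff d' X' => CAGP.posterior_isStronglyCalibrated hf hζ hfζ hy hG hGp hA haff X',
    fun m S hS => ⟨fun _ _ => rfl, CAGP.bayesSolver_isCalibrated hGp hS,
      CAGP.Solver.isAffine_of_mulVec (fun _ => rfl) _⟩,
    fun m T _ => ⟨fun _ _ => rfl, CAGP.psimSolver_isCalibrated hGp T m, ?_⟩,
    fun m hm hcard => CAGP.cgSolver_not_isAffine hGp hm hcard _⟩
  obtain ⟨M, hM⟩ := CAGP.psimSolver_mean G T m
  exact CAGP.Solver.isAffine_of_mulVec hM _
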